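/- Let $n\ge 2$. A \emph{convex surface} in $\mathbb{R}^n$ is the boundary of an $n$-dimensional convex set distinct from $\mathbb{R}^n$. A \emph{real quadric surface} is a nonempty set of the form \[ \Big\{(x_1,\dots,x_n)\in\mathbb{R}^n : \sum_{i,k=1}^n a_{ik}x_ix_k+2\sum_{i=1}^n b_ix_i+c=0\Big\} \] with real coefficients, where the symmetric matrix $(a_{ik})$ is not zero. A convex surface $S\subset\mathbb{R}^n$ is called a \emph{convex quadric} if there are a real quadric surface $Q\subset\mathbb{R}^n$ and a convex connected component $U$ of $\mathbb{R}^n\setminus Q$ such that $S$ is the boundary of $U$. A convex surface $S\subset\mathbb{R}^n$ is a convex quadric if and only if there are Cartesian (orthonormal, with arbitrary origin) coordinates $\xi_1,\dots,\xi_n$ in which $S$ is given by one of the equations \begin{align*} & a_1\xi_1^2+\cdots+a_k\xi_k^2=1, && 1\le k\le n,\\ & a_1\xi_1^2-a_2\xi_2^2-\cdots-a_k\xi_k^2=1,\quad \xi_1\ge 0, && 2\le k\le n,\\ & a_1\xi_1^2=0,\\ & a_1\xi_1^2-a_2\xi_2^2-\cdots-a_k\xi_k^2=0,\quad \xi_1\ge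 0, && 2\le k\le n,\\ & a_1\xi_1^2+\cdots+a_{k-1}\xi_{k-1}^2=\xi_k, && 2\le k\le n, \end{align*} where all scalars $a_i$ involved are positive. -/

import Mathlib

/-- A real quadric surface in `ℝⁿ`: a nonempty locus
`∑ aᵢₖ ξᵢ ξₖ + 2 ∑ bᵢ ξᵢ + c = 0`, where the (symmetric) coefficient matrix `(aᵢₖ)` is not zero. -/
def IsRealQuadric {n : ℕ} (Q : Set (EuclideanSpace ℝ (Fin n))) : Prop :=
  Q.Nonempty ∧
    ∃ (A : Matrix (Fin n) (Fin n) ℝ) (b : Fin n → ℝ) (c : ℝ), A.IsSymm ∧ A ≠ 0 ∧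
      Q = {x | (∑ i, ∑ k, A i k * x i * x k) + 2 * (∑ i, b i * x i) + c = 0}

/-- A convex surface: the boundary of an `n`-dimensional convex set distinct from `ℝⁿ`. -/
def IsConvexSurface {n : ℕ} (S : Set (EuclideanSpace ℝ (Fin n))) : Prop :=
  ∃ K : Set (EuclideanSpace ℝ (Fin n)),
    Convex ℝ K ∧ affineSpan ℝ K = ⊤ ∧ K ≠ Set.univ ∧ S = frontier K

/-- A convex quadric: a convex surface which is the boundary of a convex connected component `U`
of the complement of a real quadric surface. -/
def IsConvexQuadric {n : ℕ} (S : Set (EuclideanSpace ℝ (Fin n))) : Prop :=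
  IsConvexSurface S ∧
    ∃ Q : Set (EuclideanSpace ℝ (Fin n)), IsRealQuadric Q ∧
      ∃ p ∈ Qᶜ, Convex ℝ (connectedComponentIn Qᶜ p) ∧ S = frontier (connectedComponentIn Qᶜ p)

/-!
The five canonical loci in coordinates `ξ`. Indices run over `Fin n`, so they start at `0`, and
`j` is the index of the last variable involved: `j = k - 1` in terms of the number `k` of variables.
-/

/-- `a₁ξ₁² + ⋯ + aₖξₖ² = 1`. -/
def ellipticLocus {n : ℕ} (a : Fin n → ℝ) (j : Fin n) : Set (EuclideanSpace ℝ (Fin n)) :=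
  {ξ | ∑ i ∈ Finset.Iic j, a i * ξ i ^ 2 = 1}

/-- `a₁ξ₁² - a₂ξ₂² - ⋯ - aₖξₖ² = 1`, `ξ₁ ≥ 0`. -/
def hyperbolicLocus {n : ℕ} [NeZero n] (a : Fin n → ℝ) (j : Fin n) :
    Set (EuclideanSpace ℝ (Fin n)) :=
  {ξ | a 0 * ξ 0 ^ 2 - ∑ i ∈ Finset.Ioc 0 j, a i * ξ i ^ 2 = 1 ∧ 0 ≤ ξ 0}

/-- `a₁ξ₁² = 0`. -/
def planeLocus {n : ℕ} [NeZero n] (a : Fin n → ℝ) : Set (EuclideanSpace ℝ (Fin n)) :=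
  {ξ | a 0 * ξ 0 ^ 2 = 0}

/-- `a₁ξ₁² - a₂ξ₂² - ⋯ - aₖξₖ² = 0`, `ξ₁ ≥ 0`. -/
def coneLocus {n : ℕ} [NeZero n] (a : Fin n → ℝ) (j : Fin n) : Set (EuclideanSpace ℝ (Fin n)) :=
  {ξ | a 0 * ξ 0 ^ 2 - ∑ i ∈ Finset.Ioc 0 j, a i * ξ i ^ 2 = 0 ∧ 0 ≤ ξ 0}

/-- `a₁ξ₁² + ⋯ + aₖ₋₁ξₖ₋₁² = ξₖ`. -/
def parabolicLocus {n : ℕ} (a : Fin n → ℝ) (j : Fin n) : Set (EuclideanSpace ℝ (Fin n)) :=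
  {ξ | ∑ i ∈ Finset.Iio j, a i * ξ i ^ 2 = ξ j}

/-- The set `T` of coordinate vectors is one of the five canonical loci, with all coefficients
that occur in its equation positive. -/
def IsCanonicalLocus {n : ℕ} [NeZero n] (T : Set (EuclideanSpace ℝ (Fin n))) : Prop :=
  ∃ a : Fin n → ℝ,
    (∃ j : Fin n, (∀ i ≤ j, 0 < a i) ∧ T = ellipticLocus a j) ∨
    (∃ j : Fin n, 0 < j ∧ (∀ i ≤ j, 0 < a i) ∧ T = hyperbolicLocus a j) ∨
    (0 < a 0 ∧ T = planeLocus a) ∨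
    (∃ j : Fin n, 0 < j ∧ (∀ i ≤ j, 0 < a i) ∧ T = coneLocus a j) ∨
    (∃ j : Fin n, 0 < j ∧ (∀ i < j, 0 < a i) ∧ T = parabolicLocus a j)

/-! Diagonalizing the quadratic part and completing squares turns the quadric into the zero set of F
= ∑ lam i * x i ^ 2 + β * x m + c. After possibly changing the sign of F, the component U becomes a
convex open region V with F > 0 on V and F = 0 on its frontier (`IsConvexPositivityRegion`). Such a
V swallows every connected set on which F > 0 and which meets V.

Convexity of V allows at most one positive coefficient (`pos_unique`). With two of them, moving far
along one axis produces a line in V parallel to the other axis; the frontier of V is then invariant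
along that direction, yet F vanishes on the frontier and is genuinely quadratic in that direction.

If no coefficient is positive, F is concave and V = {F > 0}: this gives elliptic and parabolic loci.
If only lam k is positive, F ≤ 0 on the hyperplane x k = 0 (`le_of_pos`). This forces β = 0 and c ≤
0, and up to reflection V = {F > 0, x k > 0}: the frontier is a sheet of a hyperboloid, a half-cone
or a hyperplane.

Conversely, these two kinds of model region are convex and open, and their frontiers are the
canonical loci and lie in {F = 0}; so they are connected components of the complement of {F = 0}. -/

/-- The quadratic polynomial `∑ lam i * x i ^ 2 + β * x m + c` without mixed terms. -/
noncomputable def diagQuad {n : ℕ} (lam : Fin n → ℝ) (β : ℝ) (m : Fin n) (c : ℝ)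
    (x : EuclideanSpace ℝ (Fin n)) : ℝ :=
  ∑ i, lam i * x i ^ 2 + β * x m + c

/-! ### Diagonal quadratic polynomials and the concave case -/

section diagQuad

variable {n : ℕ} (lam : Fin n → ℝ) (β : ℝ) (m : Fin n) (c : ℝ)

theorem continuous_diagQuad : Continuous (diagQuad lam β m c) := by
  unfold diagQuad
  fun_prop

theorem diagQuad_neg (x : EuclideanSpace ℝ (Fin n)) :
    diagQuad (-lam) (-β) m (-c) x = -diagQuad lam β m c x := by
  simp only [diagQuad, Pi.neg_apply, neg_mul, Finset.sum_neg_distrib]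
  ring

theorem diagQuad_apply_neg (x : EuclideanSpace ℝ (Fin n)) :
    diagQuad lam β m c (-x) = diagQuad lam (-β) m c x := by
  simp [diagQuad]

/-- The defect from affinity along a segment is the pure quadratic form of x - y, so only the signs
of `lam` on the nonzero coordinates of x - y matter for concavity. -/
theorem diagQuad_combo (x y : EuclideanSpace ℝ (Fin n)) {s t : ℝ} (hst : s + t = 1) :
    diagQuad lam β m c (s • x + t • y) =
      s * diagQuad lam β m c x + t * diagQuad lam β m c y
        - s * t * ∑ i, lam i * (x i - y i) ^ 2 := by
  obtain rfl : s = 1 - t := by linarith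
  have h : ∀ i, lam i * ((1 - t) * x i + t * y i) ^ 2 =
      (1 - t) * (lam i * x i ^ 2) + t * (lam i * y i ^ 2)
        - (1 - t) * t * (lam i * (x i - y i) ^ 2) := fun i => by ring
  simp only [diagQuad, PiLp.add_apply, PiLp.smul_apply, smul_eq_mul, h, Finset.sum_sub_distrib,
    Finset.sum_add_distrib, ← Finset.mul_sum]
  ring

/-- The derivative of `diagQuad` in the direction of the `i`-th axis. -/
noncomputable def diagQuadSlope (i : Fin n) (x : EuclideanSpace ℝ (Fin n)) : ℝ :=
  2 * lam i * x i + if i = m then β else 0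

theorem diagQuad_add_single (x : EuclideanSpace ℝ (Fin n)) (i : Fin n) (t : ℝ) :
    diagQuad lam β m c (x + t • EuclideanSpace.single i 1) =
      diagQuad lam β m c x + t * diagQuadSlope lam β m i x + lam i * t ^ 2 := by
  have h : ∀ k, lam k * (x k + t * (if k = i then 1 else 0)) ^ 2 =
      lam k * x k ^ 2 + if k = i then lam i * (2 * t * x i + t ^ 2) else 0 := by
    intro k
    split_ifs with hk
    · subst hk; ring
    · ring
  simp only [diagQuad, diagQuadSlope, PiLp.add_apply, PiLp.smul_apply, smul_eq_mul,
    PiLp.single_apply, h, Finset.sum_add_distrib, Finset.sum_ite_eq', Finset.mem_univ,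
    if_true, @eq_comm _ m i]
  split_ifs <;> ring

variable {lam β m c}

theorem convex_diagQuad_pos (hl : ∀ i, lam i ≤ 0) : Convex ℝ {x | 0 < diagQuad lam β m c x} := by
  intro x hx y hy s t hs ht hst
  have hx' : 0 < diagQuad lam β m c x := hx
  have hy' : 0 < diagQuad lam β m c y := hy
  have h : ∑ i, lam i * (x i - y i) ^ 2 ≤ 0 :=
    Finset.sum_nonpos fun i _ => mul_nonpos_of_nonpos_of_nonneg (hl i) (sq_nonneg _)
  have h1 := mul_nonneg (mul_nonneg hs ht) (neg_nonneg.2 h)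
  have h2 : 0 < s * diagQuad lam β m c x + t * diagQuad lam β m c y := by
    rcases hs.eq_or_lt with rfl | hs
    · rw [zero_add] at hst; subst hst; simpa using hy'
    · exact add_pos_of_pos_of_nonneg (mul_pos hs hx') (mul_nonneg ht hy'.le)
  rw [Set.mem_ofPred_eq, diagQuad_combo _ _ _ _ _ _ hst]
  linarith

/-- By concavity, the open segment from a zero to a point of positivity consists of points of
positivity, so every zero is a limit of them. -/
theorem frontier_diagQuad_pos (hl : ∀ i, lam i ≤ 0)
    (hne : ∃ x, 0 < diagQuad lam β m c x) :
    frontier {x | 0 < diagQuad lam β m c x} = {x | diagQuad lam β m c x = 0} := by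
  have hcont := continuous_diagQuad lam β m c
  apply Set.Subset.antisymm
  · intro x hx
    exact (frontier_lt_subset_eq continuous_const hcont hx).symm
  · intro x hx
    have hx' : diagQuad lam β m c x = 0 := hx
    obtain ⟨p, hp⟩ := hne
    refine ⟨?_, fun h => ?_⟩
    · have htend : Filter.Tendsto (fun t : ℝ => (1 - t) • x + t • p)
          (nhdsWithin 0 (Set.Ioo 0 1)) (nhds x) := by
        have hc : Continuous (fun t : ℝ => (1 - t) • x + t • p) := by fun_prop
        have := (hc.tendsto 0).mono_left (nhdsWithin_le_nhds (s := Set.Ioo (0 : ℝ) 1))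
        simpa using this
      have hbot : (nhdsWithin (0 : ℝ) (Set.Ioo 0 1)).NeBot := by
        rw [← mem_closure_iff_nhdsWithin_neBot, closure_Ioo (by norm_num)]
        simp
      refine mem_closure_of_tendsto htend ?_
      filter_upwards [self_mem_nhdsWithin] with t ht
      have hs : ∑ i, lam i * (x i - p i) ^ 2 ≤ 0 :=
        Finset.sum_nonpos fun i _ => mul_nonpos_of_nonpos_of_nonneg (hl i) (sq_nonneg _)
      have h1 := mul_nonneg (mul_nonneg (sub_nonneg.2 ht.2.le) ht.1.le) (neg_nonneg.2 hs)
      have h2 := mul_pos ht.1 hp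
      change 0 < diagQuad lam β m c _
      rw [diagQuad_combo _ _ _ _ _ _ (by ring), hx']
      linarith
    · have h' : x ∈ {x | 0 < diagQuad lam β m c x} := interior_subset h
      exact hx'.not_gt h'

end diagQuad

/-! ### Components, frontiers and lines in convex sets -/

theorem IsPreconnected.subset_of_disjoint_frontier {X : Type*} [TopologicalSpace X] {V C : Set X}
    (hC : IsPreconnected C) (hV : IsOpen V) (hne : (C ∩ V).Nonempty)
    (hd : ∀ x ∈ C, x ∉ frontier V) : C ⊆ V := by
  refine hC.subset_of_closure_inter_subset hV hne fun x hx => ?_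
  by_contra hxV
  exact hd x hx.2 ⟨hx.1, by rwa [hV.interior_eq]⟩

theorem connectedComponentIn_eq_of_frontier_subset {X : Type*} [TopologicalSpace X]
    {U Q : Set X} {p : X} (hU : IsOpen U) (hc : IsPreconnected U) (hp : p ∈ U)
    (hd : U ⊆ Qᶜ) (hf : frontier U ⊆ Q) : connectedComponentIn Qᶜ p = U := by
  apply Set.Subset.antisymm
  · exact isPreconnected_connectedComponentIn.subset_of_disjoint_frontier hU
      ⟨p, mem_connectedComponentIn (hd hp), hp⟩
      fun x hx hx' => connectedComponentIn_subset _ _ hx (hf hx')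
  · exact hc.subset_connectedComponentIn hp hd

/-- A frontier point outside Q would have its own component as an open neighbourhood; that component
meets the given one, hence equals it. -/
theorem frontier_connectedComponentIn_compl_subset {X : Type*} [TopologicalSpace X]
    [LocallyConnectedSpace X] {Q : Set X} (hQ : IsClosed Q) (p : X) :
    frontier (connectedComponentIn Qᶜ p) ⊆ Q := by
  intro x hx
  by_contra hxQ
  have ho : IsOpen (connectedComponentIn Qᶜ p) := hQ.isOpen_compl.connectedComponentIn
  obtain ⟨y, hy1, hy2⟩ := mem_closure_iff.1 hx.1 _
    (hQ.isOpen_compl.connectedComponentIn (x := x)) (mem_connectedComponentIn hxQ)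
  have h : x ∈ connectedComponentIn Qᶜ p := by
    rw [connectedComponentIn_eq hy2, ← connectedComponentIn_eq hy1]
    exact mem_connectedComponentIn hxQ
  exact hx.2 (by rwa [ho.interior_eq])

/-- The frontier of a convex set that contains a line is invariant under
translations along the line. -/
theorem Convex.add_smul_mem_frontier {E : Type*} [AddCommGroup E] [Module ℝ E] [TopologicalSpace E]
    [IsTopologicalAddGroup E] [ContinuousSMul ℝ E] {V : Set E} (hV : Convex ℝ V)
    {p d : E} (hline : ∀ t : ℝ, p + t • d ∈ V) {w : E} (hw : w ∈ frontier V) (t : ℝ) :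
    w + t • d ∈ frontier V := by
  have hcl : ∀ t : ℝ, w + t • d ∈ closure V := by
    intro t
    have htend : Filter.Tendsto (fun s : ℝ => (1 - s) • w + s • p + t • d)
        (nhdsWithin 0 (Set.Ioo 0 1)) (nhds (w + t • d)) := by
      have hc : Continuous (fun s : ℝ => (1 - s) • w + s • p + t • d) := by fun_prop
      have := (hc.tendsto 0).mono_left (nhdsWithin_le_nhds (s := Set.Ioo (0 : ℝ) 1))
      simpa using this
    have hbot : (nhdsWithin (0 : ℝ) (Set.Ioo 0 1)).NeBot := by
      rw [← mem_closure_iff_nhdsWithin_neBot, closure_Ioo (by norm_num)]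
      simp
    refine isClosed_closure.mem_of_tendsto htend ?_
    filter_upwards [self_mem_nhdsWithin] with s hs
    -- Aiming at the remote point p + (t / s) • d with weight s contributes exactly t • d, while s •
    -- p vanishes as s tends to 0.
    have h := hV.closure hw.1 (subset_closure (hline (t / s))) (sub_nonneg.2 hs.2.le) hs.1.le
      (by ring)
    rwa [smul_add, smul_smul, mul_div_cancel₀ _ hs.1.ne', ← add_assoc] at h
  refine ⟨hcl t, fun h => hw.2 ?_⟩
  -- w is the midpoint of w + t • d, supposed interior, and w - t • d, which lies in the closure.
  have := hV.combo_interior_closure_mem_interior h (hcl (-t)) (a := 1 / 2) (b := 1 / 2)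
    (by norm_num) (by norm_num) (by norm_num)
  convert this using 1
  module

/-! ### Convex positivity regions and the signs of the coefficients -/

/-- `V` behaves like a convex connected component of the locus where `f` is positive. -/
structure IsConvexPositivityRegion {n : ℕ} (f : EuclideanSpace ℝ (Fin n) → ℝ)
    (V : Set (EuclideanSpace ℝ (Fin n))) : Prop where
  isOpen : IsOpen V
  convex : Convex ℝ V
  nonempty : V.Nonempty
  ne_univ : V ≠ Set.univ
  pos : ∀ x ∈ V, 0 < f x
  eq_zero : ∀ x ∈ frontier V, f x = 0

namespace IsConvexPositivityRegion

variable {n : ℕ}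

theorem subset_of_isPreconnected {f : EuclideanSpace ℝ (Fin n) → ℝ}
    {V : Set (EuclideanSpace ℝ (Fin n))} (h : IsConvexPositivityRegion f V)
    {C : Set (EuclideanSpace ℝ (Fin n))} (hC : IsPreconnected C) (hpos : ∀ x ∈ C, 0 < f x)
    {p : EuclideanSpace ℝ (Fin n)} (hpC : p ∈ C) (hpV : p ∈ V) : C ⊆ V :=
  hC.subset_of_disjoint_frontier h.isOpen ⟨p, hpC, hpV⟩
    fun x hx hx' => (hpos x hx).ne' (h.eq_zero x hx')

theorem image {f g : EuclideanSpace ℝ (Fin n) → ℝ} {V : Set (EuclideanSpace ℝ (Fin n))}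
    (h : IsConvexPositivityRegion f V)
    (e : EuclideanSpace ℝ (Fin n) ≃ᵃⁱ[ℝ] EuclideanSpace ℝ (Fin n)) (hfg : ∀ x, f x = g (e x)) :
    IsConvexPositivityRegion g (e '' V) where
  isOpen := e.toHomeomorph.isOpenMap V h.isOpen
  convex := h.convex.affine_image e.toAffineEquiv.toAffineMap
  nonempty := h.nonempty.image _
  ne_univ := by
    intro hu
    apply h.ne_univ
    rw [← Set.preimage_image_eq V e.injective, hu, Set.preimage_univ]
  pos := by
    rintro _ ⟨x, hx, rfl⟩
    exact hfg x ▸ h.pos x hx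
  eq_zero := by
    intro y hy
    have : e '' frontier V = frontier (e '' V) := e.toHomeomorph.image_frontier V
    rw [← this] at hy
    obtain ⟨x, hx, rfl⟩ := hy
    exact hfg x ▸ h.eq_zero x hx

variable {lam : Fin n → ℝ} {β c : ℝ} {m : Fin n} {V : Set (EuclideanSpace ℝ (Fin n))}

theorem image_neg (h : IsConvexPositivityRegion (diagQuad lam β m c) V) :
    IsConvexPositivityRegion (diagQuad lam (-β) m c)
      ((LinearIsometryEquiv.neg ℝ (E := EuclideanSpace ℝ (Fin n))).toAffineIsometryEquiv '' V) :=
  h.image _ fun x => by simp [diagQuad_apply_neg]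

theorem ray_subset (h : IsConvexPositivityRegion (diagQuad lam β m c) V)
    {p : EuclideanSpace ℝ (Fin n)} (hp : p ∈ V) {i : Fin n} {s : ℝ}
    (hpos : ∀ t, 0 ≤ t → 0 < diagQuad lam β m c (p + (t * s) • EuclideanSpace.single i 1))
    {t : ℝ} (ht : 0 ≤ t) : p + (t * s) • EuclideanSpace.single i 1 ∈ V := by
  have hc : Continuous fun t : ℝ => p + (t * s) • EuclideanSpace.single i (1 : ℝ) := by fun_prop
  refine h.subset_of_isPreconnected ((isPreconnected_Ici (a := (0 : ℝ))).image _ hc.continuousOn)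
    ?_ ⟨0, by simp, by simp⟩ hp ⟨t, ht, rfl⟩
  rintro _ ⟨t, ht, rfl⟩
  exact hpos t ht

/-- Otherwise the whole line lies in V, and the frontier is invariant along it. -/
theorem exists_nonpos_on_line (h : IsConvexPositivityRegion (diagQuad lam β m c) V)
    {p : EuclideanSpace ℝ (Fin n)} (hp : p ∈ V) {i : Fin n} (hi : lam i ≠ 0) :
    ∃ t : ℝ, diagQuad lam β m c (p + t • EuclideanSpace.single i 1) ≤ 0 := by
  by_contra! hpos
  have hline : ∀ t : ℝ, p + t • EuclideanSpace.single i (1 : ℝ) ∈ V := by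
    intro t
    have hc : Continuous fun t : ℝ => p + t • EuclideanSpace.single i (1 : ℝ) := by fun_prop
    refine h.subset_of_isPreconnected ((isPreconnected_univ (α := ℝ)).image _ hc.continuousOn)
      ?_ ⟨0, by simp, by simp⟩ hp ⟨t, trivial, rfl⟩
    rintro _ ⟨t, -, rfl⟩
    exact hpos t
  obtain ⟨w, hw⟩ : (frontier V).Nonempty := by
    rw [nonempty_frontier_iff]
    exact ⟨h.nonempty, h.ne_univ⟩
  -- Along the line through w, F is quadratic with leading coefficient `lam i` and vanishes at -1, 0
  -- and 1.
  have h0 := h.eq_zero w hw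
  have h1 := h.eq_zero _ (h.convex.add_smul_mem_frontier hline hw 1)
  have h2 := h.eq_zero _ (h.convex.add_smul_mem_frontier hline hw (-1))
  rw [diagQuad_add_single] at h1 h2
  apply hi
  linarith

theorem pos_unique (h : IsConvexPositivityRegion (diagQuad lam β m c) V) {i k : Fin n}
    (hi : 0 < lam i) (hk : 0 < lam k) : i = k := by
  by_contra hik
  obtain ⟨p, hp⟩ := h.nonempty
  have hFp := h.pos p hp
  -- The sign s orients the i-th axis so that F grows at least quadratically from p.
  obtain ⟨s, hs, hslope⟩ : ∃ s : ℝ, s ^ 2 = 1 ∧ 0 ≤ s * diagQuadSlope lam β m i p := by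
    rcases le_total 0 (diagQuadSlope lam β m i p) with h0 | h0
    · exact ⟨1, by norm_num, by linarith⟩
    · exact ⟨-1, by norm_num, by linarith⟩
  have hray : ∀ t, 0 ≤ t → diagQuad lam β m c p + lam i * t ^ 2 ≤
      diagQuad lam β m c (p + (t * s) • EuclideanSpace.single i 1) := by
    intro t ht
    rw [diagQuad_add_single]
    have := mul_nonneg ht hslope
    have e : lam i * (t * s) ^ 2 = lam i * t ^ 2 := by rw [mul_pow, hs, mul_one]
    rw [e]
    linarith
  set D := diagQuadSlope lam β m k p with hD
  -- D ^ 2 / (4 * lam k) is the largest drop of F along the k-th axis. Moving along the i-th axis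
  -- does not change D, so the gain there can outweigh this drop.
  obtain ⟨t, ht0, ht⟩ : ∃ t : ℝ, 0 ≤ t ∧ D ^ 2 / (4 * lam k) ≤ lam i * t ^ 2 := by
    refine ⟨√(D ^ 2 / (4 * lam k) / lam i), Real.sqrt_nonneg _, ?_⟩
    rw [Real.sq_sqrt (by positivity), mul_div_cancel₀ _ hi.ne']
  have hmem : p + (t * s) • EuclideanSpace.single i 1 ∈ V := by
    refine h.ray_subset hp (fun t ht => ?_) ht0
    have := hray t ht
    have := mul_nonneg hi.le (sq_nonneg t)
    linarith
  obtain ⟨y, hy⟩ := h.exists_nonpos_on_line hmem hk.ne'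
  rw [diagQuad_add_single] at hy
  have hslope' : diagQuadSlope lam β m k (p + (t * s) • EuclideanSpace.single i 1) = D := by
    simp [hD, diagQuadSlope, Ne.symm hik]
  rw [hslope'] at hy
  have h1 := hray t ht0
  have h2 : D ^ 2 / (4 * lam k) + y * D + lam k * y ^ 2 = lam k * (y + D / (2 * lam k)) ^ 2 := by
    field_simp
    ring
  have h3 := mul_nonneg hk.le (sq_nonneg (y + D / (2 * lam k)))
  linarith

theorem eq_of_nonpos (h : IsConvexPositivityRegion (diagQuad lam β m c) V)
    (hl : ∀ i, lam i ≤ 0) : V = {x | 0 < diagQuad lam β m c x} := by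
  obtain ⟨p, hp⟩ := h.nonempty
  exact Set.Subset.antisymm (fun x hx => h.pos x hx)
    (h.subset_of_isPreconnected (convex_diagQuad_pos hl).isPreconnected (fun x hx => hx)
      (h.pos p hp) hp)

/-! ### Regions with one positive coefficient -/

section OnePositive

variable (h : IsConvexPositivityRegion (diagQuad lam β m c) V) {k : Fin n} (hk : 0 < lam k)
  (hm : β ≠ 0 → lam m = 0)

include hk hm

theorem diagQuadSlope_eq (x : EuclideanSpace ℝ (Fin n)) :
    diagQuadSlope lam β m k x = 2 * lam k * x k := by
  unfold diagQuadSlope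
  split_ifs with hkm
  · have : β = 0 := by
      by_contra hβ
      exact hk.ne' (hkm ▸ hm hβ)
    simp [this]
  · simp

include h

/-- Translating a point far enough along the axis with the positive coefficient moves it into
the region. -/
theorem exists_add_single_mem {p : EuclideanSpace ℝ (Fin n)} (hp : p ∈ V) (hpk : 0 < p k)
    (x : EuclideanSpace ℝ (Fin n)) (t₀ : ℝ) :
    ∃ t ≥ t₀, x + t • EuclideanSpace.single k 1 ∈ V := by
  have hF := h.pos p hp
  set r := lam k * x k ^ 2 - diagQuad lam β m c x with hr
  -- M is the common k-th coordinate of x' and p': large enough that p moves forward, that the shift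
  -- of x is at least t₀, and that F is positive at x'. The positive coefficient then plays no role
  -- on the segment from p' to x', where F is concave.
  set M := max (p k) (max (x k + t₀) (1 + |r| / lam k)) with hM
  have hM1 : p k ≤ M := le_max_left _ _
  have hM2 : x k + t₀ ≤ M := (le_max_left _ _).trans (le_max_right _ _)
  have hM3 : 1 + |r| / lam k ≤ M := (le_max_right _ _).trans (le_max_right _ _)
  have hrM : r < lam k * M ^ 2 := by
    have h0 : 0 ≤ |r| / lam k := by positivity
    have h1 : |r| / lam k < M ^ 2 := by nlinarith
    rw [div_lt_iff₀ hk] at h1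
    linarith [le_abs_self r]
  refine ⟨M - x k, by linarith, ?_⟩
  set x' := x + (M - x k) • EuclideanSpace.single k (1 : ℝ) with hx'
  set p' := p + ((M - p k) * 1) • EuclideanSpace.single k (1 : ℝ) with hp'
  have hx'F : 0 < diagQuad lam β m c x' := by
    rw [hx', diagQuad_add_single, diagQuadSlope_eq hk hm]
    linarith
  have hp'V : p' ∈ V := by
    refine h.ray_subset hp (fun t ht => ?_) (by linarith)
    rw [diagQuad_add_single, diagQuadSlope_eq hk hm]
    have := mul_nonneg ht (mul_nonneg hk.le hpk.le)
    have := mul_nonneg hk.le (sq_nonneg t)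
    linarith
  have hp'F := h.pos p' hp'V
  have hl : ∀ i, i ≠ k → lam i ≤ 0 := by
    intro i hi
    by_contra! hi'
    exact hi (h.pos_unique hi' hk)
  refine h.subset_of_isPreconnected (convex_segment p' x').isPreconnected ?_
    (left_mem_segment ℝ p' x') hp'V (right_mem_segment ℝ p' x')
  rintro _ ⟨a, b, ha, hb, hab, rfl⟩
  rw [diagQuad_combo _ _ _ _ _ _ hab]
  have hs : ∑ i, lam i * (p' i - x' i) ^ 2 ≤ 0 := by
    refine Finset.sum_nonpos fun i _ => ?_
    by_cases hi : i = k
    · subst hi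
      simp [hp', hx']
    · exact mul_nonpos_of_nonpos_of_nonneg (hl i hi) (sq_nonneg _)
  have h1 := mul_nonneg (mul_nonneg ha hb) (neg_nonneg.2 hs)
  have h2 : 0 < a * diagQuad lam β m c p' + b * diagQuad lam β m c x' := by
    rcases ha.eq_or_lt with rfl | ha
    · rw [zero_add] at hab; subst hab; simpa using hx'F
    · exact add_pos_of_pos_of_nonneg (mul_pos ha hp'F) (mul_nonneg hb hx'F.le)
  linarith

/-- If this failed, F would be positive on the whole line through x along the k-th axis, and that
line meets V. -/
theorem le_of_pos {p : EuclideanSpace ℝ (Fin n)} (hp : p ∈ V) (hpk : 0 < p k)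
    (x : EuclideanSpace ℝ (Fin n)) : diagQuad lam β m c x ≤ lam k * x k ^ 2 := by
  by_contra! hx
  obtain ⟨t, -, ht⟩ := h.exists_add_single_mem hk hm hp hpk x 0
  obtain ⟨s, hs⟩ := h.exists_nonpos_on_line ht hk.ne'
  rw [add_assoc, ← add_smul, diagQuad_add_single, diagQuadSlope_eq hk hm] at hs
  have := mul_nonneg hk.le (sq_nonneg (x k + (t + s)))
  linarith

theorem eq_of_pos {p : EuclideanSpace ℝ (Fin n)} (hp : p ∈ V) (hpk : 0 < p k) :
    V = {x | 0 < diagQuad lam β m c x ∧ 0 < x k} := by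
  have hle := h.le_of_pos hk hm hp hpk
  have hne : ∀ x ∈ V, x k ≠ 0 := by
    intro x hx hx0
    have := hle x
    have h' := h.pos x hx
    rw [hx0] at this
    linarith
  apply Set.Subset.antisymm
  · refine fun x hx => ⟨h.pos x hx, ?_⟩
    by_contra! hxk
    have hpx : 0 < p k - x k := by linarith
    -- The segment from p to x crosses the hyperplane of vanishing k-th coordinate, which V avoids.
    have := h.convex hp hx (a := -x k / (p k - x k)) (b := p k / (p k - x k))
      (div_nonneg (by linarith) hpx.le) (div_nonneg hpk.le hpx.le) (by field_simp; ring)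
    refine hne _ this ?_
    simp
    ring
  · rintro x ⟨hx, hxk⟩
    obtain ⟨t, ht0, ht⟩ := h.exists_add_single_mem hk hm hp hpk x 0
    refine h.subset_of_isPreconnected (convex_segment x (x + t • EuclideanSpace.single k 1)
      ).isPreconnected ?_ (right_mem_segment ℝ _ _) ht (left_mem_segment ℝ _ _)
    rintro _ ⟨a, b, ha, hb, hab, rfl⟩
    have : a • x + b • (x + t • EuclideanSpace.single k (1 : ℝ)) =
        x + (b * t) • EuclideanSpace.single k (1 : ℝ) := by
      rw [smul_add, ← add_assoc, ← add_smul, hab, one_smul, smul_smul]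
    rw [this, diagQuad_add_single, diagQuadSlope_eq hk hm]
    have hbt := mul_nonneg hb ht0
    have := mul_nonneg hbt (mul_nonneg hk.le hxk.le)
    have := mul_nonneg hk.le (sq_nonneg (b * t))
    linarith

theorem eq_zero_of_pos {p : EuclideanSpace ℝ (Fin n)} (hp : p ∈ V) (hpk : 0 < p k) :
    β = 0 := by
  by_contra hβ
  have hm0 := hm hβ
  have hmk : m ≠ k := by
    rintro rfl
    exact hk.ne' hm0
  -- At this point F takes the value 1, although the k-th coordinate is 0.
  have := h.le_of_pos hk hm hp hpk (0 + ((1 - c) / β) • EuclideanSpace.single m 1)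
  rw [diagQuad_add_single] at this
  simp [diagQuad, diagQuadSlope, hm0, hmk.symm, div_mul_cancel₀ _ hβ] at this
  linarith

theorem const_nonpos_of_pos {p : EuclideanSpace ℝ (Fin n)} (hp : p ∈ V) (hpk : 0 < p k) :
    c ≤ 0 := by
  simpa [diagQuad] using h.le_of_pos hk hm hp hpk 0

end OnePositive

end IsConvexPositivityRegion

/-! ### One sheet of a hyperboloid or cone -/

section Sheet

variable {n : ℕ} {lam : Fin n → ℝ} {c : ℝ} {k : Fin n}

/-- F is a quadratic form in the homogeneous vector X = (x, 1). The mixed term of X and Y is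
expressed through the form at τ X - Y, with τ free to be chosen. -/
theorem diagQuad_zero_combo (m : Fin n) (x y : EuclideanSpace ℝ (Fin n)) {s t τ : ℝ}
    (hst : s + t = 1) (hτ : τ ≠ 0) :
    diagQuad lam 0 m c (s • x + t • y) =
      (s ^ 2 + s * t * τ) * diagQuad lam 0 m c x + (t ^ 2 + s * t / τ) * diagQuad lam 0 m c y
        - s * t / τ * (∑ i, lam i * (τ * x i - y i) ^ 2 + c * (τ - 1) ^ 2) := by
  obtain rfl : s = 1 - t := by linarith
  have h : ∀ i, lam i * ((1 - t) * x i + t * y i) ^ 2 =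
      ((1 - t) ^ 2 + (1 - t) * t * τ) * (lam i * x i ^ 2)
        + (t ^ 2 + (1 - t) * t / τ) * (lam i * y i ^ 2)
        - (1 - t) * t / τ * (lam i * (τ * x i - y i) ^ 2) := by
    intro i
    field_simp
    ring
  simp only [diagQuad, PiLp.add_apply, PiLp.smul_apply, smul_eq_mul, h, Finset.sum_sub_distrib,
    Finset.sum_add_distrib, ← Finset.mul_sum]
  field_simp
  ring

/-- A reverse Cauchy–Schwarz argument: τ = y k / x k kills the k-th coordinate of τ X - Y, the only
direction of positive sign. -/
theorem convex_sheet (m : Fin n) (hl : ∀ i, i ≠ k → lam i ≤ 0) (hc : c ≤ 0) :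
    Convex ℝ {x | 0 < diagQuad lam 0 m c x ∧ 0 < x k} := by
  rintro x ⟨hx, hxk⟩ y ⟨hy, hyk⟩ s t hs ht hst
  have hτ : 0 < y k / x k := div_pos hyk hxk
  have hpos : 0 < s ∨ 0 < t := by
    by_contra! h
    linarith
  refine ⟨?_, ?_⟩
  · rw [diagQuad_zero_combo m x y hst hτ.ne']
    have h1 : ∑ i, lam i * (y k / x k * x i - y i) ^ 2 + c * (y k / x k - 1) ^ 2 ≤ 0 := by
      refine add_nonpos (Finset.sum_nonpos fun i _ => ?_)
        (mul_nonpos_of_nonpos_of_nonneg hc (sq_nonneg _))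
      by_cases hi : i = k
      · subst hi
        rw [div_mul_cancel₀ _ hxk.ne']
        simp
      · exact mul_nonpos_of_nonpos_of_nonneg (hl i hi) (sq_nonneg _)
    have h2 := mul_nonneg (div_nonneg (mul_nonneg hs ht) hτ.le) (neg_nonneg.2 h1)
    have h3 : 0 ≤ s * t * (y k / x k) := by positivity
    have h4 : 0 ≤ s * t / (y k / x k) := by positivity
    have h5 : 0 < (s ^ 2 + s * t * (y k / x k)) * diagQuad lam 0 m c x
        + (t ^ 2 + s * t / (y k / x k)) * diagQuad lam 0 m c y := by
      rcases hpos with h | h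
      · have : 0 < s ^ 2 := by positivity
        exact add_pos_of_pos_of_nonneg (mul_pos (by linarith) hx)
          (mul_nonneg (add_nonneg (sq_nonneg _) h4) hy.le)
      · have : 0 < t ^ 2 := by positivity
        exact add_pos_of_nonneg_of_pos (mul_nonneg (add_nonneg (sq_nonneg _) h3) hx.le)
          (mul_pos (by linarith) hy)
    linarith
  · simp only [PiLp.add_apply, PiLp.smul_apply, smul_eq_mul]
    rcases hpos with h | h
    · exact add_pos_of_pos_of_nonneg (mul_pos h hxk) (mul_nonneg ht hyk.le)
    · exact add_pos_of_nonneg_of_pos (mul_nonneg hs hxk.le) (mul_pos h hyk)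

theorem isOpen_sheet (m : Fin n) : IsOpen {x | 0 < diagQuad lam 0 m c x ∧ 0 < x k} :=
  (isOpen_lt continuous_const (continuous_diagQuad lam 0 m c)).inter
    (isOpen_lt continuous_const (EuclideanSpace.proj k).continuous)

theorem diagQuad_zero_add_single (m : Fin n) (x : EuclideanSpace ℝ (Fin n)) (t : ℝ) :
    diagQuad lam 0 m c (x + t • EuclideanSpace.single k 1) =
      diagQuad lam 0 m c x + lam k * (2 * t * x k + t ^ 2) := by
  rw [diagQuad_add_single]
  simp only [diagQuadSlope, ite_self]
  ring

theorem sheet_nonempty (m : Fin n) (hk : 0 < lam k) :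
    {x | 0 < diagQuad lam 0 m c x ∧ 0 < x k}.Nonempty := by
  have h0 : 0 ≤ |c| / lam k := by positivity
  refine ⟨0 + (1 + |c| / lam k) • EuclideanSpace.single k 1, ?_, by simp; linarith⟩
  rw [diagQuad_zero_add_single]
  have h1 : |c| / lam k < (1 + |c| / lam k) ^ 2 := by nlinarith
  rw [div_lt_iff₀ hk] at h1
  simp only [diagQuad, PiLp.zero_apply]
  have := neg_abs_le c
  simp
  linarith

/-- F ≤ c ≤ 0 where x k = 0, so this hyperplane adds no frontier points with F > 0. Conversely,
increasing x k from a zero with x k ≥ 0 enters the sheet region. -/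
theorem frontier_sheet (m : Fin n) (hk : 0 < lam k) (hl : ∀ i, i ≠ k → lam i ≤ 0) (hc : c ≤ 0) :
    frontier {x | 0 < diagQuad lam 0 m c x ∧ 0 < x k} =
      {x | diagQuad lam 0 m c x = 0 ∧ 0 ≤ x k} := by
  have hcont := continuous_diagQuad lam 0 m c
  rw [(isOpen_sheet m).frontier_eq]
  apply Set.Subset.antisymm
  · rintro x ⟨hx, hx'⟩
    have hcl : IsClosed {x | 0 ≤ diagQuad lam 0 m c x ∧ 0 ≤ x k} :=
      (isClosed_le continuous_const hcont).inter (isClosed_le continuous_const (EuclideanSpace.proj k).continuous)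
    obtain ⟨h1, h2⟩ := closure_minimal (fun x (hx : 0 < diagQuad lam 0 m c x ∧ 0 < x k) =>
      (⟨hx.1.le, hx.2.le⟩ : 0 ≤ diagQuad lam 0 m c x ∧ 0 ≤ x k)) hcl hx
    refine ⟨le_antisymm ?_ h1, h2⟩
    by_contra! hpos
    rcases h2.eq_or_lt with h0 | h0
    · have : ∑ i, lam i * x i ^ 2 ≤ 0 := by
        refine Finset.sum_nonpos fun i _ => ?_
        by_cases hi : i = k
        · subst hi
          simp [← h0]
        · exact mul_nonpos_of_nonpos_of_nonneg (hl i hi) (sq_nonneg _)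
      simp only [diagQuad] at hpos
      linarith
    · exact hx' ⟨hpos, h0⟩
  · rintro x ⟨hx, hxk⟩
    refine ⟨?_, fun h => h.1.ne' hx⟩
    have htend : Filter.Tendsto (fun t : ℝ => x + t • EuclideanSpace.single k (1 : ℝ))
        (nhdsWithin 0 (Set.Ioi 0)) (nhds x) := by
      have hc : Continuous (fun t : ℝ => x + t • EuclideanSpace.single k (1 : ℝ)) := by fun_prop
      have := (hc.tendsto 0).mono_left (nhdsWithin_le_nhds (s := Set.Ioi (0 : ℝ)))
      simpa using this
    refine mem_closure_of_tendsto htend ?_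
    filter_upwards [self_mem_nhdsWithin] with t ht
    have ht' : 0 < t := ht
    refine ⟨?_, ?_⟩
    · rw [diagQuad_zero_add_single, hx]
      positivity
    · simp
      linarith

end Sheet

/-! ### Quadrics and their normal forms -/

/-- The solution set of a quadratic equation without mixed terms in Cartesian coordinates is a real
quadric. -/
theorem isRealQuadric_diagQuad {n : ℕ} {lam : Fin n → ℝ} {β c : ℝ} {m : Fin n}
    (e : EuclideanSpace ℝ (Fin n) ≃ᵃⁱ[ℝ] EuclideanSpace ℝ (Fin n)) (hlam : ∃ i, lam i ≠ 0)
    (hne : ∃ x, diagQuad lam β m c x = 0) :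
    IsRealQuadric {x | diagQuad lam β m c (e x) = 0} := by
  set v : Fin n → EuclideanSpace ℝ (Fin n) :=
    fun i => e.linearIsometryEquiv.symm (EuclideanSpace.single i 1) with hv
  have hin : ∀ i y, e.linearIsometryEquiv y i = ∑ j, v i j * y j := by
    intro i y
    have h1 : e.linearIsometryEquiv y i = inner ℝ (v i) y := by
      rw [hv, ← e.linearIsometryEquiv.inner_map_map]
      simp [EuclideanSpace.inner_single_left]
    rw [h1, PiLp.inner_apply]
    simp [mul_comm]
  have he : ∀ x i, e x i = ∑ j, v i j * x j + e 0 i := by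
    intro x i
    have := e.map_vadd 0 x
    simp only [vadd_eq_add, add_zero] at this
    rw [this, PiLp.add_apply, hin]
  refine ⟨?_, fun j k => ∑ i, lam i * v i j * v i k,
    fun j => ∑ i, lam i * v i j * e 0 i + β * v m j / 2, diagQuad lam β m c (e 0), ?_, ?_, ?_⟩
  · obtain ⟨x, hx⟩ := hne
    exact ⟨e.symm x, by simpa using hx⟩
  · exact Matrix.IsSymm.ext fun j k => Finset.sum_congr rfl fun i _ => by ring
  · intro h0
    obtain ⟨i₀, hi₀⟩ := hlam
    -- The form evaluated at the axis vector `v i₀` returns `lam i₀`, so the matrix is not zero.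
    have key : ∑ j, ∑ k, (∑ i, lam i * v i j * v i k) * v i₀ j * v i₀ k = lam i₀ := by
      have : ∀ i, ∑ j, v i j * v i₀ j = if i₀ = i then 1 else 0 := by
        intro i
        rw [← hin, hv]
        simp [eq_comm]
      calc ∑ j, ∑ k, (∑ i, lam i * v i j * v i k) * v i₀ j * v i₀ k
          = ∑ j, ∑ k, ∑ i, lam i * (v i j * v i₀ j) * (v i k * v i₀ k) := by
            refine Finset.sum_congr rfl fun j _ => Finset.sum_congr rfl fun k _ => ?_
            rw [Finset.sum_mul, Finset.sum_mul]
            exact Finset.sum_congr rfl fun i _ => by ring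
        _ = ∑ i, lam i * (∑ j, v i j * v i₀ j) * (∑ k, v i k * v i₀ k) := by
            simp_rw [Finset.mul_sum, Finset.sum_mul]
            rw [Finset.sum_comm, Finset.sum_congr rfl fun k _ => Finset.sum_comm,
              Finset.sum_comm]
        _ = lam i₀ := by
            simp [this]
    apply hi₀
    rw [← key]
    have h0' : ∀ j k, ∑ i, lam i * v i j * v i k = 0 := fun j k => congrFun (congrFun h0 j) k
    simp [h0']
  · ext x
    have key : diagQuad lam β m c (e x) =
        (∑ j, ∑ k, (∑ i, lam i * v i j * v i k) * x j * x k)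
          + 2 * (∑ j, (∑ i, lam i * v i j * e 0 i + β * v m j / 2) * x j)
          + diagQuad lam β m c (e 0) := by
      have h1 : (∑ j, ∑ k, (∑ i, lam i * v i j * v i k) * x j * x k) =
          ∑ i, lam i * (∑ j, v i j * x j) ^ 2 := by
        simp_rw [sq, Finset.sum_mul_sum, Finset.mul_sum, Finset.sum_mul]
        rw [Finset.sum_congr rfl fun j _ => Finset.sum_comm, Finset.sum_comm]
        exact Finset.sum_congr rfl fun i _ => Finset.sum_congr rfl fun j _ =>
          Finset.sum_congr rfl fun k _ => by ring
      have h2 : (∑ j, (∑ i, lam i * v i j * e 0 i + β * v m j / 2) * x j) =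
          ∑ i, lam i * e 0 i * (∑ j, v i j * x j) + β / 2 * ∑ j, v m j * x j := by
        simp_rw [add_mul, Finset.sum_add_distrib, Finset.mul_sum, Finset.sum_mul]
        rw [Finset.sum_comm]
        congr 1
        · exact Finset.sum_congr rfl fun i _ => Finset.sum_congr rfl fun j _ => by ring
        · exact Finset.sum_congr rfl fun j _ => by ring
      rw [h1, h2]
      have h3 : ∀ i, lam i * (∑ j, v i j * x j + e 0 i) ^ 2 =
          lam i * (∑ j, v i j * x j) ^ 2 + 2 * (lam i * e 0 i * (∑ j, v i j * x j))
            + lam i * e 0 i ^ 2 := fun i => by ring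
      simp only [diagQuad, he x, h3, Finset.sum_add_distrib, ← Finset.mul_sum]
      ring
    rw [Set.mem_ofPred_eq, Set.mem_ofPred_eq, key]

/-- The function `q` has the form `∑ lam i * ξ i ^ 2 + β * ξ m + c` in suitable Cartesian
coordinates `ξ`, where `ξ m` does not occur squared and `c = 0` if the linear term is present. -/
def HasNormalForm {n : ℕ} (q : EuclideanSpace ℝ (Fin n) → ℝ) : Prop :=
  ∃ (e : EuclideanSpace ℝ (Fin n) ≃ᵃⁱ[ℝ] EuclideanSpace ℝ (Fin n)) (lam : Fin n → ℝ) (β c : ℝ)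
    (m : Fin n), (∃ i, lam i ≠ 0) ∧ (β ≠ 0 → lam m = 0 ∧ c = 0) ∧
      ∀ x, q x = diagQuad lam β m c (e x)

theorem HasNormalForm.comp {n : ℕ} {q r : EuclideanSpace ℝ (Fin n) → ℝ} (h : HasNormalForm r)
    (e : EuclideanSpace ℝ (Fin n) ≃ᵃⁱ[ℝ] EuclideanSpace ℝ (Fin n)) (hq : ∀ x, q x = r (e x)) :
    HasNormalForm q := by
  obtain ⟨f, lam, β, c, m, h1, h2, h3⟩ := h
  exact ⟨e.trans f, lam, β, c, m, h1, h2, fun x => by rw [hq, h3]; rfl⟩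

/-- The vector b is orthogonal to all axes that occur squared, so its normalization can replace one
of the remaining axes; a translation along it absorbs c. -/
theorem HasNormalForm.of_separated {n : ℕ} [NeZero n] {lam b : Fin n → ℝ} (c : ℝ)
    (hlam : ∃ i, lam i ≠ 0) (hb : ∀ i, lam i ≠ 0 → b i = 0) :
    HasNormalForm fun x : EuclideanSpace ℝ (Fin n) =>
      ∑ i, lam i * x i ^ 2 + 2 * ∑ i, b i * x i + c := by
  by_cases hb0 : b = 0
  · exact ⟨AffineIsometryEquiv.refl ℝ _, lam, 0, c, 0, hlam, by simp, by simp [hb0, diagQuad]⟩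
  obtain ⟨m, hm⟩ : ∃ m, b m ≠ 0 := Function.ne_iff.1 hb0
  have hlm : lam m = 0 := by
    by_contra h
    exact hm (hb m h)
  set b' : EuclideanSpace ℝ (Fin n) := WithLp.toLp 2 b with hb'
  have hb'0 : b' ≠ 0 := fun h => hm (by simpa [hb'] using congrArg (fun y => y m) h)
  have hN : 0 < ‖b'‖ := norm_pos_iff.2 hb'0
  set v : Fin n → EuclideanSpace ℝ (Fin n) :=
    fun i => if i = m then ‖b'‖⁻¹ • b' else EuclideanSpace.single i 1 with hv
  have hort : Orthonormal ℝ (Set.domRestrict {i | lam i ≠ 0 ∨ i = m} v) := by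
    rw [orthonormal_iff_ite]
    rintro ⟨i, hi⟩ ⟨j, hj⟩
    simp only [Set.domRestrict_apply, hv, Subtype.mk.injEq]
    by_cases him : i = m <;> by_cases hjm : j = m
    · subst him hjm
      simp [norm_smul, hN.ne']
    · have hij : i ≠ j := fun h => hjm (h ▸ him)
      have hbj := hb j (hj.resolve_right hjm)
      simp [him, hjm, Ne.symm hjm, EuclideanSpace.inner_single_right, hb', hbj]
    · have hij : i ≠ j := fun h => him (h ▸ hjm)
      have hbi := hb i (hi.resolve_right him)
      simp [him, hjm, EuclideanSpace.inner_single_left, hb', hbi]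
    · simp [him, hjm, EuclideanSpace.inner_single_left, PiLp.single_apply]
  obtain ⟨w, hw⟩ := hort.exists_orthonormalBasis_extension_of_card_eq (by simp)
  have hwm : ∀ x : EuclideanSpace ℝ (Fin n), ∑ i, b i * x i = ‖b'‖ * w.repr x m := by
    intro x
    rw [OrthonormalBasis.repr_apply_apply, hw m (Or.inr rfl), hv]
    simp only [if_true, real_inner_smul_left]
    rw [mul_inv_cancel_left₀ hN.ne', PiLp.inner_apply]
    simp [hb', mul_comm]
  have hwi : ∀ (x : EuclideanSpace ℝ (Fin n)) i, lam i * x i ^ 2 = lam i * w.repr x i ^ 2 := by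
    intro x i
    by_cases hi : lam i = 0
    · simp [hi]
    · have him : i ≠ m := by
        rintro rfl
        exact hi hlm
      rw [OrthonormalBasis.repr_apply_apply, hw i (Or.inl hi)]
      simp [hv, him, EuclideanSpace.inner_single_left]
  refine ⟨w.repr.toAffineIsometryEquiv.trans (AffineIsometryEquiv.constVAdd ℝ _
    ((c / (2 * ‖b'‖)) • EuclideanSpace.single m 1)), lam, 2 * ‖b'‖, 0, m, hlam,
    fun _ => ⟨hlm, rfl⟩, fun x => ?_⟩
  have : diagQuad lam (2 * ‖b'‖) m 0 ((w.repr.toAffineIsometryEquiv.trans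
      (AffineIsometryEquiv.constVAdd ℝ _ ((c / (2 * ‖b'‖)) • EuclideanSpace.single m 1))) x) =
      diagQuad lam (2 * ‖b'‖) m 0 (w.repr x + (c / (2 * ‖b'‖)) • EuclideanSpace.single m 1) := by
    congr 1
    simp [add_comm]
  beta_reduce
  rw [this, diagQuad_add_single, hwm, Finset.sum_congr rfl fun i _ => hwi x i]
  simp only [diagQuad, diagQuadSlope, hlm, if_true]
  field_simp
  ring

theorem HasNormalForm.of_diagonal {n : ℕ} [NeZero n] {lam : Fin n → ℝ} (b : Fin n → ℝ) (c : ℝ)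
    (hlam : ∃ i, lam i ≠ 0) :
    HasNormalForm fun x : EuclideanSpace ℝ (Fin n) =>
      ∑ i, lam i * x i ^ 2 + 2 * ∑ i, b i * x i + c := by
  -- Completing squares; since division by zero gives 0, axes with `lam i = 0` are not shifted.
  set o : EuclideanSpace ℝ (Fin n) := WithLp.toLp 2 fun i => b i / lam i with ho
  refine (HasNormalForm.of_separated (lam := lam) (b := fun i => if lam i = 0 then b i else 0)
    (c - ∑ i, b i ^ 2 / lam i) hlam (fun i hi => by simp [hi])).comp
    (AffineIsometryEquiv.constVAdd ℝ _ o) fun x => ?_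
  have h : ∀ i, lam i * (b i / lam i + x i) ^ 2 +
      2 * ((if lam i = 0 then b i else 0) * (b i / lam i + x i)) =
      lam i * x i ^ 2 + 2 * (b i * x i) + b i ^ 2 / lam i := by
    intro i
    by_cases hi : lam i = 0
    · simp [hi]
    · simp only [hi, if_false]
      field_simp
      ring
  have h' := Finset.sum_congr (rfl : (Finset.univ : Finset (Fin n)) = _) fun i _ => h i
  simp only [Finset.sum_add_distrib, ← Finset.mul_sum] at h'
  simp only [AffineIsometryEquiv.coe_constVAdd, vadd_eq_add, PiLp.add_apply, ho]
  linarith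

theorem Matrix.IsSymm.exists_orthonormalBasis_sum_eq {n : ℕ} {A : Matrix (Fin n) (Fin n) ℝ}
    (hA : A.IsSymm) :
    ∃ (v : OrthonormalBasis (Fin n) ℝ (EuclideanSpace ℝ (Fin n))) (lam : Fin n → ℝ),
      ∀ x : EuclideanSpace ℝ (Fin n),
        ∑ i, ∑ k, A i k * x i * x k = ∑ i, lam i * v.repr x i ^ 2 := by
  have hH : A.IsHermitian := by
    rw [Matrix.IsHermitian, Matrix.conjTranspose_eq_transpose_of_trivial]
    exact hA
  have hT := Matrix.isSymmetric_toEuclideanLin_iff.2 hH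
  refine ⟨hT.eigenvectorBasis (by simp), hT.eigenvalues (by simp), fun x => ?_⟩
  set v := hT.eigenvectorBasis (n := n) (by simp)
  have h1 : ∑ i, ∑ k, A i k * x i * x k = inner ℝ x (Matrix.toEuclideanLin A x) := by
    rw [PiLp.inner_apply]
    refine Finset.sum_congr rfl fun i _ => ?_
    simp only [Matrix.toLpLin_apply, Matrix.mulVec, dotProduct, RCLike.inner_apply,
      conj_trivial, Finset.sum_mul]
    exact Finset.sum_congr rfl fun k _ => by ring
  rw [h1, ← v.sum_inner_mul_inner]
  refine Finset.sum_congr rfl fun i _ => ?_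
  rw [← hT, hT.apply_eigenvectorBasis, real_inner_smul_left, OrthonormalBasis.repr_apply_apply,
    real_inner_comm]
  simp only [RCLike.ofReal_real_eq_id, id]
  ring

theorem HasNormalForm.of_matrix {n : ℕ} [NeZero n] {A : Matrix (Fin n) (Fin n) ℝ} (hA : A.IsSymm)
    (hA0 : A ≠ 0) (b : Fin n → ℝ) (c : ℝ) :
    HasNormalForm fun x : EuclideanSpace ℝ (Fin n) =>
      (∑ i, ∑ k, A i k * x i * x k) + 2 * (∑ i, b i * x i) + c := by
  obtain ⟨v, lam, hv⟩ := hA.exists_orthonormalBasis_sum_eq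
  have hlam : ∃ i, lam i ≠ 0 := by
    by_contra! h0
    apply hA0
    simp only [h0, zero_mul, Finset.sum_const_zero] at hv
    have hd : ∀ i, A i i = 0 := fun i => by
      simpa [PiLp.single_apply] using hv (EuclideanSpace.single i 1)
    ext i j
    by_cases hij : i = j
    · subst hij
      exact hd i
    have h := hv (EuclideanSpace.single i 1 + EuclideanSpace.single j 1)
    simp [PiLp.single_apply, mul_add, Finset.sum_add_distrib, hd] at h
    have := hA.apply i j
    simp only [Matrix.zero_apply]
    linarith
  refine (HasNormalForm.of_diagonal (lam := lam) (v.repr (WithLp.toLp 2 b)) c hlam).comp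
    v.repr.toAffineIsometryEquiv fun x => ?_
  rw [hv]
  have : ∑ i, b i * x i = ∑ i, v.repr (WithLp.toLp 2 b) i * v.repr x i := by
    have h := v.repr.inner_map_map (WithLp.toLp 2 b) x
    rw [PiLp.inner_apply, PiLp.inner_apply] at h
    simpa [mul_comm] using h.symm
  simp [this]

/-! ### Permuting coordinates into canonical order -/

theorem Finset.exists_perm_mem_iff {α : Type*} [Fintype α] [DecidableEq α] {I J : Finset α}
    (h : I.card = J.card) : ∃ σ : Equiv.Perm α, ∀ i, i ∈ I ↔ σ i ∈ J := by
  refine ⟨(Finset.equivOfCardEq h).extendSubtype, fun i => ?_⟩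
  by_cases hi : i ∈ I
  · exact iff_of_true hi (Equiv.extendSubtype_mem _ i hi)
  · exact iff_of_false hi (Equiv.extendSubtype_not_mem _ i hi)

theorem Finset.exists_perm_mem_iff_of_notMem {α : Type*} [Fintype α] [DecidableEq α]
    {I J : Finset α} (h : I.card = J.card) {k l : α} (hk : k ∉ I) (hl : l ∉ J) :
    ∃ σ : Equiv.Perm α, σ k = l ∧ ∀ i, i ∈ I ↔ σ i ∈ J := by
  obtain ⟨σ, hσ⟩ := Finset.exists_perm_mem_iff h
  have hσk : σ k ∉ J := fun h => hk ((hσ k).2 h)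
  refine ⟨σ.trans (Equiv.swap (σ k) l), by simp, fun i => ?_⟩
  rw [hσ i, Equiv.trans_apply, Equiv.swap_apply_def]
  split_ifs with h1 h2
  · rw [h1]
    exact iff_of_false hσk hl
  · rw [h2]
    exact iff_of_false hl hσk
  · rfl

theorem Finset.sum_perm_mul_sq {n : ℕ} {I J : Finset (Fin n)} {σ : Equiv.Perm (Fin n)} (hσ : ∀ i, i ∈ I ↔ σ i ∈ J)
    (a ξ : Fin n → ℝ) :
    ∑ i ∈ I, a i * ξ (σ i) ^ 2 = ∑ j ∈ J, a (σ.symm j) * ξ j ^ 2 :=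
  Finset.sum_equiv σ hσ fun i _ => by simp

/-- The set `S` is a canonical locus in suitable Cartesian coordinates. -/
def HasCanonicalCoordinates {n : ℕ} [NeZero n] (S : Set (EuclideanSpace ℝ (Fin n))) : Prop :=
  ∃ e : EuclideanSpace ℝ (Fin n) ≃ᵃⁱ[ℝ] EuclideanSpace ℝ (Fin n), IsCanonicalLocus (e '' S)

namespace HasCanonicalCoordinates

variable {n : ℕ} [NeZero n]

theorem of_image {S : Set (EuclideanSpace ℝ (Fin n))}
    (e : EuclideanSpace ℝ (Fin n) ≃ᵃⁱ[ℝ] EuclideanSpace ℝ (Fin n))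
    (h : HasCanonicalCoordinates (e '' S)) : HasCanonicalCoordinates S := by
  obtain ⟨f, hf⟩ := h
  exact ⟨e.trans f, by rwa [AffineIsometryEquiv.coe_trans, Set.image_comp]⟩

theorem frontier_of_image {V : Set (EuclideanSpace ℝ (Fin n))}
    (e : EuclideanSpace ℝ (Fin n) ≃ᵃⁱ[ℝ] EuclideanSpace ℝ (Fin n))
    (h : HasCanonicalCoordinates (frontier (e '' V))) :
    HasCanonicalCoordinates (frontier V) := by
  apply of_image e
  rwa [show e '' frontier V = frontier (e '' V) from e.toHomeomorph.image_frontier V]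

/-- Coordinates may be permuted. -/
theorem of_perm {S : Set (EuclideanSpace ℝ (Fin n))} (σ : Equiv.Perm (Fin n))
    (h : IsCanonicalLocus {ξ : EuclideanSpace ℝ (Fin n) |
      WithLp.toLp 2 (fun i => ξ (σ i)) ∈ S}) : HasCanonicalCoordinates S := by
  refine ⟨(LinearIsometryEquiv.piLpCongrLeft 2 ℝ ℝ σ).toAffineIsometryEquiv, ?_⟩
  convert h using 1
  rw [LinearIsometryEquiv.coe_toAffineIsometryEquiv]
  ext ξ
  constructor
  · rintro ⟨x, hx, rfl⟩
    have : (WithLp.toLp 2 fun i => LinearIsometryEquiv.piLpCongrLeft 2 ℝ ℝ σ x (σ i)) = x := by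
      ext i
      simp [LinearIsometryEquiv.piLpCongrLeft_apply]
    rwa [Set.mem_ofPred_eq, this]
  · intro hξ
    refine ⟨_, hξ, ?_⟩
    ext i
    simp [LinearIsometryEquiv.piLpCongrLeft_apply]

theorem elliptic {I : Finset (Fin n)} (hI : I.Nonempty) {a : Fin n → ℝ} (ha : ∀ i ∈ I, 0 < a i) :
    HasCanonicalCoordinates {x : EuclideanSpace ℝ (Fin n) | ∑ i ∈ I, a i * x i ^ 2 = 1} := by
  have hc := hI.card_pos
  have hcn : I.card ≤ n := by simpa using Finset.card_le_univ I
  -- Indices start at 0, so the last of the `I.card` variables has index `I.card - 1`.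
  obtain ⟨σ, hσ⟩ := Finset.exists_perm_mem_iff (I := I)
    (J := Finset.Iic (⟨I.card - 1, by omega⟩ : Fin n)) (by rw [Fin.card_Iic]; simp; omega)
  refine of_perm σ ⟨fun j => a (σ.symm j), Or.inl ⟨⟨I.card - 1, by omega⟩, fun i hi => ha _ ?_, ?_⟩⟩
  · rw [hσ]
    simpa using hi
  · ext ξ
    simp only [ellipticLocus, Set.mem_ofPred_eq, Finset.sum_perm_mul_sq hσ]

/-- Index 0 is reserved for the distinguished variable k, so the variables in I occupy 1 up to
`I.card`. -/
theorem exists_perm_Ioc {I : Finset (Fin n)} {k : Fin n} (hk : k ∉ I) :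
    ∃ (σ : Equiv.Perm (Fin n)) (j : Fin n), (j : ℕ) = I.card ∧ σ k = 0 ∧
      ∀ i, i ∈ I ↔ σ i ∈ Finset.Ioc 0 j := by
  have hcn : I.card < n := by simpa using Finset.card_lt_univ_of_notMem hk
  obtain ⟨σ, h1, h2⟩ := Finset.exists_perm_mem_iff_of_notMem (I := I)
    (J := Finset.Ioc 0 (⟨I.card, hcn⟩ : Fin n)) (by rw [Fin.card_Ioc]; simp) hk
    (l := 0) (by simp)
  exact ⟨σ, _, rfl, h1, h2⟩

theorem sheet {I : Finset (Fin n)} (hI : I.Nonempty) {k : Fin n} (hk : k ∉ I) {a : Fin n → ℝ}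
    (hak : 0 < a k) (ha : ∀ i ∈ I, 0 < a i) {d : ℝ} (hd : d = 0 ∨ d = 1) :
    HasCanonicalCoordinates {x : EuclideanSpace ℝ (Fin n) |
      a k * x k ^ 2 - ∑ i ∈ I, a i * x i ^ 2 = d ∧ 0 ≤ x k} := by
  obtain ⟨σ, j, hj, hσk, hσ⟩ := exists_perm_Ioc hk
  have hσ0 : σ.symm 0 = k := by rw [← hσk, Equiv.symm_apply_apply]
  have hj0 : 0 < j := by
    rw [Fin.lt_def, hj]
    simpa using hI.card_pos
  have hpos : ∀ i ≤ j, 0 < a (σ.symm i) := by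
    intro i hi
    by_cases hi0 : i = 0
    · rwa [hi0, hσ0]
    · refine ha _ ?_
      rw [hσ]
      simpa [hi] using Fin.pos_iff_ne_zero.2 hi0
  refine of_perm σ ⟨fun j => a (σ.symm j), ?_⟩
  rcases hd with rfl | rfl
  · refine Or.inr (Or.inr (Or.inr (Or.inl ⟨j, hj0, hpos, ?_⟩)))
    ext ξ
    simp only [coneLocus, Set.mem_ofPred_eq, Finset.sum_perm_mul_sq hσ, hσk, hσ0]
  · refine Or.inr (Or.inl ⟨j, hj0, hpos, ?_⟩)
    ext ξ
    simp only [hyperbolicLocus, Set.mem_ofPred_eq, Finset.sum_perm_mul_sq hσ, hσk, hσ0]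

theorem hyperplane (k : Fin n) (r : ℝ) :
    HasCanonicalCoordinates {x : EuclideanSpace ℝ (Fin n) | x k = r} := by
  refine of_image (AffineIsometryEquiv.constVAdd ℝ _ ((-r) • EuclideanSpace.single k 1))
    (of_perm (Equiv.swap k 0) ⟨1, Or.inr (Or.inr (Or.inl ⟨one_pos, ?_⟩))⟩)
  ext ξ
  simp only [planeLocus, Set.mem_ofPred_eq, Set.mem_image, AffineIsometryEquiv.coe_constVAdd,
    vadd_eq_add, Pi.one_apply, one_mul, sq_eq_zero_iff]
  constructor
  · rintro ⟨x, hx, hx'⟩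
    have := congrArg (fun y => y k) hx'
    simp [hx] at this
    exact this.symm
  · intro h
    refine ⟨r • EuclideanSpace.single k 1 + WithLp.toLp 2 fun i => ξ (Equiv.swap k 0 i), ?_, ?_⟩
    · simp [h]
    · simp [← add_assoc]

theorem parabolic {I : Finset (Fin n)} (hI : I.Nonempty) {m : Fin n} (hm : m ∉ I) {a : Fin n → ℝ}
    (ha : ∀ i ∈ I, 0 < a i) :
    HasCanonicalCoordinates {x : EuclideanSpace ℝ (Fin n) | ∑ i ∈ I, a i * x i ^ 2 = x m} := by
  have hcn : I.card < n := by simpa using Finset.card_lt_univ_of_notMem hm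
  obtain ⟨σ, hσm, hσ⟩ := Finset.exists_perm_mem_iff_of_notMem (I := I)
    (J := Finset.Iio (⟨I.card, hcn⟩ : Fin n)) (by rw [Fin.card_Iio]) hm
    (l := ⟨I.card, hcn⟩) (by simp)
  refine of_perm σ ⟨fun j => a (σ.symm j), Or.inr (Or.inr (Or.inr (Or.inr
    ⟨⟨I.card, hcn⟩, ?_, fun i hi => ha _ ?_, ?_⟩)))⟩
  · rw [Fin.lt_def]
    simpa using hI.card_pos
  · rw [hσ]
    simpa using hi
  · ext ξ
    simp only [parabolicLocus, Set.mem_ofPred_eq, Finset.sum_perm_mul_sq hσ, hσm]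

end HasCanonicalCoordinates

/-! ### From regions to canonical loci -/

namespace IsConvexPositivityRegion

variable {n : ℕ} [NeZero n] {lam : Fin n → ℝ} {β c : ℝ} {m : Fin n}
  {V : Set (EuclideanSpace ℝ (Fin n))}

theorem hasCanonicalCoordinates_of_nonpos (h : IsConvexPositivityRegion (diagQuad lam β m c) V)
    (hlam : ∃ i, lam i ≠ 0) (hm : β ≠ 0 → lam m = 0 ∧ c = 0) (hl : ∀ i, lam i ≤ 0)
    (hβ : 0 ≤ β) : HasCanonicalCoordinates (frontier V) := by
  have hne : ∃ x, 0 < diagQuad lam β m c x := h.nonempty.imp fun x hx => h.pos x hx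
  rw [h.eq_of_nonpos hl, frontier_diagQuad_pos hl hne]
  set I := Finset.univ.filter fun i => lam i ≠ 0 with hI
  have hIne : I.Nonempty := by
    obtain ⟨i, hi⟩ := hlam
    exact ⟨i, by simpa [hI] using hi⟩
  have hpos : ∀ i ∈ I, 0 < -lam i := by
    intro i hi
    have : lam i ≠ 0 := by simpa [hI] using hi
    have := lt_of_le_of_ne (hl i) this
    linarith
  have hsum : ∀ (x : EuclideanSpace ℝ (Fin n)) (r : ℝ),
      ∑ i ∈ I, -lam i / r * x i ^ 2 = -(∑ i, lam i * x i ^ 2) / r := by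
    intro x r
    rw [hI, Finset.sum_filter_of_ne, ← Finset.sum_neg_distrib, Finset.sum_div]
    · exact Finset.sum_congr rfl fun i _ => by ring
    · intro i _ hi h0
      simp [h0] at hi
  rcases hβ.eq_or_lt with rfl | hβ
  · have hc : 0 < c := by
      obtain ⟨x, hx⟩ := hne
      have : ∑ i, lam i * x i ^ 2 ≤ 0 :=
        Finset.sum_nonpos fun i _ => mul_nonpos_of_nonpos_of_nonneg (hl i) (sq_nonneg _)
      simp only [diagQuad] at hx
      linarith
    convert HasCanonicalCoordinates.elliptic hIne (a := fun i => -lam i / c)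
      fun i hi => div_pos (hpos i hi) hc using 1
    ext x
    simp only [Set.mem_ofPred_eq, hsum, diagQuad]
    rw [div_eq_one_iff_eq hc.ne']
    constructor <;> intro h <;> linarith
  · obtain ⟨hm0, rfl⟩ := hm hβ.ne'
    convert HasCanonicalCoordinates.parabolic hIne (m := m) (by simp [hI, hm0])
      (a := fun i => -lam i / β) fun i hi => div_pos (hpos i hi) hβ using 1
    ext x
    simp only [Set.mem_ofPred_eq, hsum, diagQuad]
    rw [div_eq_iff hβ.ne']
    constructor <;> intro h <;> linarith

theorem hasCanonicalCoordinates_of_pos (h : IsConvexPositivityRegion (diagQuad lam β m c) V)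
    (hm : β ≠ 0 → lam m = 0) {k : Fin n} (hk : 0 < lam k)
    {p : EuclideanSpace ℝ (Fin n)} (hp : p ∈ V) (hpk : 0 < p k) :
    HasCanonicalCoordinates (frontier V) := by
  have hβ := h.eq_zero_of_pos hk hm hp hpk
  have hc := h.const_nonpos_of_pos hk hm hp hpk
  have hl : ∀ i, i ≠ k → lam i ≤ 0 := by
    intro i hi
    by_contra! hi'
    exact hi (h.pos_unique hi' hk)
  rw [h.eq_of_pos hk hm hp hpk]
  subst hβ
  rw [frontier_sheet m hk hl hc]
  set I := Finset.univ.filter fun i => lam i ≠ 0 ∧ i ≠ k with hI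
  have hpos : ∀ i ∈ I, 0 < -lam i := by
    intro i hi
    have hi' : lam i ≠ 0 ∧ i ≠ k := by simpa [hI] using hi
    have := lt_of_le_of_ne (hl i hi'.2) hi'.1
    linarith
  have hkI : k ∉ I := by simp [hI]
  have hsum : ∀ x : EuclideanSpace ℝ (Fin n),
      ∑ i, lam i * x i ^ 2 = lam k * x k ^ 2 - ∑ i ∈ I, -lam i * x i ^ 2 := by
    intro x
    rw [← Finset.add_sum_erase _ _ (Finset.mem_univ k), sub_eq_add_neg, ← Finset.sum_neg_distrib]
    congr 1
    symm
    refine Finset.sum_subset_zero_on_sdiff (fun i hi => ?_) (fun i hi => ?_) fun i _ => by ring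
    · have hi' : lam i ≠ 0 ∧ i ≠ k := by simpa [hI] using hi
      simp [hi'.2]
    · have : lam i = 0 := by
        by_contra h0
        simp [hI, h0] at hi
      simp [this]
  rcases I.eq_empty_or_nonempty with hIe | hIne
  -- Only x k occurs: the condition x k ≥ 0 selects one of the two parallel hyperplanes, which
  -- coincide if c = 0.
  · convert HasCanonicalCoordinates.hyperplane k √(-c / lam k) using 1
    ext x
    simp only [Set.mem_ofPred_eq, diagQuad, hsum, hIe, Finset.sum_empty]
    have hr : 0 ≤ -c / lam k := div_nonneg (by linarith) hk.le
    constructor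
    · rintro ⟨h1, h2⟩
      rw [eq_comm, Real.sqrt_eq_iff_mul_self_eq hr h2, div_eq_iff hk.ne']
      linarith
    · intro hx
      refine ⟨?_, hx ▸ Real.sqrt_nonneg _⟩
      rw [hx, Real.sq_sqrt hr, mul_div_cancel₀ _ hk.ne']
      ring
  -- Dividing by -c makes the right side 1; for c = 0 it is 0 and no rescaling is needed.
  · set d := if c = 0 then 1 else -c with hd
    have hd0 : 0 < d := by
      rw [hd]
      split_ifs with h0
      · exact one_pos
      · have := lt_of_le_of_ne hc h0
        linarith
    convert HasCanonicalCoordinates.sheet hIne hkI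
      (a := fun i => (if i = k then lam i else -lam i) / d) (by simpa using div_pos hk hd0)
      (fun i hi => ?_) (d := -c / d) ?_ using 1
    · ext x
      have h1 : ∑ i ∈ I, (if i = k then lam i else -lam i) / d * x i ^ 2 =
          (∑ i ∈ I, -lam i * x i ^ 2) / d := by
        rw [Finset.sum_div]
        refine Finset.sum_congr rfl fun i hi => ?_
        have : i ≠ k := fun h => hkI (h ▸ hi)
        rw [if_neg this]
        ring
      simp only [Set.mem_ofPred_eq, diagQuad, hsum, h1, if_true]
      refine and_congr_left fun _ => ?_
      rw [div_mul_eq_mul_div, ← sub_div, div_left_inj' hd0.ne']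
      constructor <;> intro h <;> linarith
    · have : i ≠ k := fun h => hkI (h ▸ hi)
      simpa [this] using div_pos (hpos i hi) hd0
    · rw [hd]
      split_ifs with h0
      · simp [h0]
      · right
        exact div_self (neg_ne_zero.2 h0)

theorem hasCanonicalCoordinates (h : IsConvexPositivityRegion (diagQuad lam β m c) V)
    (hlam : ∃ i, lam i ≠ 0) (hm : β ≠ 0 → lam m = 0 ∧ c = 0) :
    HasCanonicalCoordinates (frontier V) := by
  have hm' : -β ≠ 0 → lam m = 0 ∧ c = 0 := fun hβ => hm (neg_ne_zero.1 hβ)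
  by_cases hl : ∀ i, lam i ≤ 0
  · rcases le_total 0 β with hβ | hβ
    · exact h.hasCanonicalCoordinates_of_nonpos hlam hm hl hβ
    · exact .frontier_of_image _
        (h.image_neg.hasCanonicalCoordinates_of_nonpos hlam hm' hl (neg_nonneg.2 hβ))
  · push Not at hl
    obtain ⟨k, hk⟩ := hl
    obtain ⟨p, hp⟩ := h.nonempty
    -- An open set is not contained in a coordinate hyperplane; reflecting in the origin then makes
    -- p k positive if necessary.
    obtain ⟨p, hp, hpk⟩ : ∃ p ∈ V, p k ≠ 0 := by
      by_contra! h0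
      obtain ⟨ε, hε, hball⟩ := Metric.isOpen_iff.1 h.isOpen p hp
      have hmem : p + (ε / 2) • EuclideanSpace.single k 1 ∈ V := by
        apply hball
        simp [norm_smul, abs_of_pos hε]
        linarith
      have h1 := h0 _ hmem
      simp [h0 p hp] at h1
      exact hε.ne' h1
    rcases hpk.lt_or_gt with hpk | hpk
    · exact .frontier_of_image _ (h.image_neg.hasCanonicalCoordinates_of_pos
        (fun hβ => (hm' hβ).1) hk (Set.mem_image_of_mem _ hp) (by simpa using hpk))
    · exact h.hasCanonicalCoordinates_of_pos (fun hβ => (hm hβ).1) hk hp hpk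

end IsConvexPositivityRegion

theorem IsConvexQuadric.hasCanonicalCoordinates {n : ℕ} [NeZero n]
    {S : Set (EuclideanSpace ℝ (Fin n))} (h : IsConvexQuadric S) : HasCanonicalCoordinates S := by
  obtain ⟨-, Q, ⟨⟨z, hz⟩, A, b, c, hA, hA0, hQ⟩, p, hp, hconv, rfl⟩ := h
  obtain ⟨e, lam, β, c', m, hlam, hm, hq⟩ := HasNormalForm.of_matrix hA hA0 b c
  have hQ' : Q = {x | diagQuad lam β m c' (e x) = 0} := by
    rw [hQ]
    ext x
    rw [Set.mem_ofPred_eq, Set.mem_ofPred_eq, ← hq x]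
  have hcont : Continuous fun x => diagQuad lam β m c' (e x) :=
    (continuous_diagQuad lam β m c').comp e.continuous
  have hclosed : IsClosed Q := by
    rw [hQ']
    exact isClosed_eq hcont continuous_const
  set U := connectedComponentIn Qᶜ p with hU
  have hpU : p ∈ U := mem_connectedComponentIn hp
  have hUQ : ∀ x ∈ U, diagQuad lam β m c' (e x) ≠ 0 := fun x hx hx' =>
    connectedComponentIn_subset _ _ hx (by rw [hQ']; exact hx')
  have hne : U ≠ Set.univ := by
    intro hu
    have : z ∈ U := hu ▸ Set.mem_univ z
    exact connectedComponentIn_subset _ _ this hz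
  have hzero : ∀ x ∈ frontier U, diagQuad lam β m c' (e x) = 0 := by
    intro x hx
    have := frontier_connectedComponentIn_compl_subset hclosed p hx
    rwa [hQ'] at this
  have hpre : IsPreconnected U := isPreconnected_connectedComponentIn
  have hsign : ∀ x ∈ U, ∀ y ∈ U, 0 < diagQuad lam β m c' (e x) →
      0 < diagQuad lam β m c' (e y) := by
    intro x hx y hy hxpos
    by_contra! hyneg
    obtain ⟨w, hw, hw0⟩ := hpre.intermediate_value hy hx hcont.continuousOn ⟨hyneg, hxpos.le⟩
    exact hUQ w hw hw0
  rcases (hUQ p hpU).lt_or_gt with hlt | hgt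
  · have hreg : IsConvexPositivityRegion (fun x => -diagQuad lam β m c' (e x)) U :=
      ⟨hclosed.isOpen_compl.connectedComponentIn, hconv, ⟨p, hpU⟩, hne, fun x hx => by
        have h1 : ¬ 0 < diagQuad lam β m c' (e x) := fun h0 => (hsign x hx p hpU h0).not_gt hlt
        have := lt_of_le_of_ne (not_lt.1 h1) (hUQ x hx)
        linarith, fun x hx => by simp [hzero x hx]⟩
    refine .frontier_of_image e ((hreg.image e
      fun x => (diagQuad_neg lam β m c' (e x)).symm).hasCanonicalCoordinates ?_ ?_)
    · simpa using hlam
    · simpa using hm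
  · have hreg : IsConvexPositivityRegion (fun x => diagQuad lam β m c' (e x)) U :=
      ⟨hclosed.isOpen_compl.connectedComponentIn, hconv, ⟨p, hpU⟩, hne,
        fun x hx => hsign p hpU x hx hgt, hzero⟩
    exact .frontier_of_image e ((hreg.image e fun _ => rfl).hasCanonicalCoordinates hlam hm)

/-! ### From canonical loci to convex quadrics -/

theorem IsConvexSurface.nonempty {n : ℕ} {S : Set (EuclideanSpace ℝ (Fin n))}
    (hS : IsConvexSurface S) : S.Nonempty := by
  obtain ⟨K, -, hK, hne, rfl⟩ := hS
  rw [nonempty_frontier_iff]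
  refine ⟨?_, hne⟩
  rw [← affineSpan_nonempty ℝ, hK]
  exact Set.univ_nonempty

theorem IsConvexSurface.isConvexQuadric_of_region {n : ℕ} {S : Set (EuclideanSpace ℝ (Fin n))}
    (hS : IsConvexSurface S) (e : EuclideanSpace ℝ (Fin n) ≃ᵃⁱ[ℝ] EuclideanSpace ℝ (Fin n))
    {lam : Fin n → ℝ} {β c : ℝ} {m : Fin n} {W : Set (EuclideanSpace ℝ (Fin n))}
    (hlam : ∃ i, lam i ≠ 0) (hW : IsOpen W) (hconv : Convex ℝ W) (hne : W.Nonempty)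
    (hpos : ∀ x ∈ W, 0 < diagQuad lam β m c x) (hf : frontier W = e '' S)
    (hzero : ∀ x ∈ e '' S, diagQuad lam β m c x = 0) : IsConvexQuadric S := by
  obtain ⟨z, hz⟩ := hS.nonempty
  have hfS : frontier (e ⁻¹' W) = S := by
    have : e ⁻¹' frontier W = frontier (e ⁻¹' W) := e.toHomeomorph.preimage_frontier W
    rw [← this, hf, Set.preimage_image_eq _ e.injective]
  obtain ⟨w, hw⟩ := hne
  have hwU : e.symm w ∈ e ⁻¹' W := by simpa using hw
  have hUQ : e ⁻¹' W ⊆ {x | diagQuad lam β m c (e x) = 0}ᶜ :=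
    fun x hx hx' => (hpos _ hx).ne' hx'
  have hconv' : Convex ℝ (e ⁻¹' W) := hconv.affine_preimage e.toAffineEquiv.toAffineMap
  have hcomp := connectedComponentIn_eq_of_frontier_subset (hW.preimage e.continuous)
    hconv'.isPreconnected hwU hUQ
    (by rw [hfS]; exact fun x hx => hzero _ (Set.mem_image_of_mem _ hx))
  refine ⟨hS, _, isRealQuadric_diagQuad e hlam ⟨e z, hzero _ (Set.mem_image_of_mem _ hz)⟩,
    e.symm w, hUQ hwU, ?_, ?_⟩
  · rwa [hcomp]
  · rw [hcomp, hfS]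

theorem IsConvexSurface.isConvexQuadric_of_nonpos {n : ℕ} {S : Set (EuclideanSpace ℝ (Fin n))}
    (hS : IsConvexSurface S) (e : EuclideanSpace ℝ (Fin n) ≃ᵃⁱ[ℝ] EuclideanSpace ℝ (Fin n))
    {lam : Fin n → ℝ} {β c : ℝ} {m : Fin n} (hlam : ∃ i, lam i ≠ 0) (hl : ∀ i, lam i ≤ 0)
    (hne : ∃ x, 0 < diagQuad lam β m c x) (heS : e '' S = {x | diagQuad lam β m c x = 0}) :
    IsConvexQuadric S :=
  hS.isConvexQuadric_of_region e hlam
    (isOpen_lt continuous_const (continuous_diagQuad lam β m c)) (convex_diagQuad_pos hl) hne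
    (fun _ hx => hx) (by rw [heS, frontier_diagQuad_pos hl hne]) (by rw [heS]; exact fun _ hx => hx)

theorem IsConvexSurface.isConvexQuadric_of_sheet {n : ℕ} [NeZero n]
    {S : Set (EuclideanSpace ℝ (Fin n))}
    (hS : IsConvexSurface S) (e : EuclideanSpace ℝ (Fin n) ≃ᵃⁱ[ℝ] EuclideanSpace ℝ (Fin n))
    {a : Fin n → ℝ} {j : Fin n} (ha : ∀ i ≤ j, 0 < a i) {d : ℝ} (hd : 0 ≤ d)
    (heS : e '' S = {x | a 0 * x 0 ^ 2 - ∑ i ∈ Finset.Ioc 0 j, a i * x i ^ 2 = d ∧ 0 ≤ x 0}) :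
    IsConvexQuadric S := by
  set lam : Fin n → ℝ := fun i => if i = 0 then a 0 else if i ≤ j then -a i else 0 with hlam
  have ha0 : 0 < a 0 := ha 0 (Fin.zero_le j)
  have hk : 0 < lam 0 := by simpa [hlam] using ha0
  have hl : ∀ i, i ≠ 0 → lam i ≤ 0 := by
    intro i hi
    simp only [hlam, hi, if_false]
    split_ifs with hij
    · have := ha i hij
      linarith
    · exact le_rfl
  have hc : -d ≤ 0 := by linarith
  have hF : ∀ x : EuclideanSpace ℝ (Fin n), diagQuad lam 0 0 (-d) x =
      a 0 * x 0 ^ 2 - ∑ i ∈ Finset.Ioc 0 j, a i * x i ^ 2 - d := by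
    intro x
    have : ∑ i, lam i * x i ^ 2 = a 0 * x 0 ^ 2 + ∑ i ∈ Finset.Ioc 0 j, -(a i * x i ^ 2) := by
      rw [← Finset.add_sum_erase _ _ (Finset.mem_univ (0 : Fin n)),
        show lam 0 = a 0 by simp [hlam]]
      congr 1
      · symm
        refine Finset.sum_subset_zero_on_sdiff (fun i hi => ?_) (fun i hi => ?_) fun i hi => ?_
        · have hi' := Finset.mem_Ioc.1 hi
          simp [hi'.1.ne']
        · have h0 : i ≠ 0 := by
            rintro rfl
            simp at hi
          have hij : ¬ i ≤ j := fun h => by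
            simp [h0, h, Fin.pos_iff_ne_zero.2 h0] at hi
          simp [hlam, h0, hij]
        · have hi' := Finset.mem_Ioc.1 hi
          simp [hlam, hi'.1.ne', hi'.2]
    rw [Finset.sum_neg_distrib] at this
    simp only [diagQuad, this]
    ring
  have heS' : e '' S = {x | diagQuad lam 0 0 (-d) x = 0 ∧ 0 ≤ x 0} := by
    rw [heS]
    ext x
    rw [Set.mem_ofPred_eq, Set.mem_ofPred_eq, hF, sub_eq_zero]
  exact hS.isConvexQuadric_of_region e ⟨0, hk.ne'⟩ (isOpen_sheet 0) (convex_sheet 0 hl hc)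
    (sheet_nonempty 0 hk) (fun _ hx => hx.1) (by rw [heS', frontier_sheet 0 hk hl hc])
    (by rw [heS']; exact fun _ hx => hx.1)

theorem IsConvexSurface.isConvexQuadric_of_isCanonicalLocus {n : ℕ} [NeZero n]
    {S : Set (EuclideanSpace ℝ (Fin n))} (hS : IsConvexSurface S)
    (e : EuclideanSpace ℝ (Fin n) ≃ᵃⁱ[ℝ] EuclideanSpace ℝ (Fin n))
    (h : IsCanonicalLocus (e '' S)) : IsConvexQuadric S := by
  have hsum : ∀ (J : Finset (Fin n)) (a : Fin n → ℝ) (x : EuclideanSpace ℝ (Fin n)),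
      ∑ i, (if i ∈ J then -a i else 0) * x i ^ 2 = -∑ i ∈ J, a i * x i ^ 2 := by
    intro J a x
    simp [ite_mul, Finset.sum_ite_mem]
  have hnonpos : ∀ (J : Finset (Fin n)) (a : Fin n → ℝ), (∀ i ∈ J, 0 < a i) →
      ∀ i, (if i ∈ J then -a i else 0) ≤ 0 := by
    intro J a ha i
    split_ifs with hi
    · have := ha i hi
      linarith
    · exact le_rfl
  obtain ⟨a, ⟨j, ha, heS⟩ | ⟨j, -, ha, heS⟩ | ⟨ha, heS⟩ | ⟨j, -, ha, heS⟩ | ⟨j, hj, ha, heS⟩⟩ := h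
  · refine hS.isConvexQuadric_of_nonpos e
      (lam := fun i => if i ∈ Finset.Iic j then -a i else 0) (β := 0) (c := 1) (m := 0)
      ⟨j, by simpa using (ha j le_rfl).ne'⟩ (hnonpos _ _ (by simpa using ha))
      ⟨0, by simp [diagQuad]⟩ ?_
    rw [heS]
    ext x
    simp only [ellipticLocus, diagQuad, Set.mem_ofPred_eq, hsum]
    constructor <;> intro h <;> linarith
  · exact hS.isConvexQuadric_of_sheet e ha zero_le_one heS
  -- A hyperplane is the degenerate sheet with no negative squares; the region is an open
  -- half-space.
  · refine hS.isConvexQuadric_of_sheet e (a := a) (j := 0) (d := 0) ?_ le_rfl ?_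
    · intro i hi
      rwa [le_antisymm hi (Fin.zero_le i)]
    · rw [heS]
      ext x
      simp only [planeLocus, Set.mem_ofPred_eq, Finset.Ioc_self, Finset.sum_empty, sub_zero]
      refine ⟨fun h => ⟨h, ?_⟩, fun h => h.1⟩
      rw [mul_eq_zero, or_iff_right ha.ne', sq_eq_zero_iff] at h
      exact h.ge
  · exact hS.isConvexQuadric_of_sheet e ha le_rfl heS
  -- F is the j-th coordinate minus the sum of squares, positive at the j-th unit vector; 0 < j
  -- ensures that a square occurs.
  · refine hS.isConvexQuadric_of_nonpos e
      (lam := fun i => if i ∈ Finset.Iio j then -a i else 0) (β := 1) (c := 0) (m := j)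
      ⟨0, by simpa [hj] using (ha 0 hj).ne'⟩ (hnonpos _ _ (by simpa using ha))
      ⟨EuclideanSpace.single j 1, ?_⟩ ?_
    · simp only [diagQuad, hsum]
      simp
    · rw [heS]
      ext x
      simp only [parabolicLocus, diagQuad, Set.mem_ofPred_eq, hsum]
      constructor <;> intro h <;> linarith

/-- A system of Cartesian coordinates is an affine isometry `e` of `ℝⁿ`, which sends a point to its
coordinate vector. -/
theorem corollary1 {n : ℕ} [NeZero n] (hn : 2 ≤ n) (S : Set (EuclideanSpace ℝ (Fin n)))
    (hS : IsConvexSurface S) :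
    IsConvexQuadric S ↔
      ∃ e : EuclideanSpace ℝ (Fin n) ≃ᵃⁱ[ℝ] EuclideanSpace ℝ (Fin n),
        IsCanonicalLocus (e '' S) :=
  ⟨fun h => h.hasCanonicalCoordinates,
    fun ⟨e, he⟩ => hS.isConvexQuadric_of_isCanonicalLocus e he⟩
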